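/- All spaces are completely regular and Hausdorff. An extension of a space $X$ is a space $T$ containing $X$ as a dense subspace; its remainder is $T\setminus X$; two extensions are identified if some homeomorphism between them fixes $X$ pointwise; and $T\le T'$ means that there is a continuous map $T'\to T$ fixing $X$ pointwise. A space is pseudocompact if every continuous real-valued function on it is bounded. Let $\mathscr U(X)$ be the set of all (equivalence classes of) pseudocompact extensions of $X$ with compact remainder, partially ordered by $\le$. Let $\beta X$ be the Stone–Čech compactification of $X$ and let $\upsilon X\subseteq\beta X$ be the Hewitt realcompactification of $X$, i.e. the largest subspace of $\beta X$ containing $X$ to which every continuous function $X\to\mathbb R$ extends continuously. Theorem. Let $X$ and $Y$ be locally compact, non-pseudocompact spaces. If $\mathscr U(X)$ and $\mathscr U(Y)$ are order-isomorphic, then the subspaces $(\beta X\setminus X)\setminus\mathrm{cl}_{\beta X}(\beta X\setminus\upsilon X)$ of $\beta X$ and $(\beta Y\setminus Y)\setminus\mathrm{cl}_{\beta Y}(\beta Y\setminus\upsilon Y)$ of $\beta Y$ are homeomorphic. -/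

import Mathlib

/-- A space is pseudocompact if every continuous real-valued function on it is bounded. -/
def IsPseudocompactSpace (X : Type*) [TopologicalSpace X] : Prop :=
  ∀ f : X → ℝ, Continuous f → ∃ C : ℝ, ∀ x, |f x| ≤ C

/-- The Hewitt realcompactification `υX` as a subset of the Stone–Čech compactification `βX`:
the largest subset of `βX` to which every continuous `f : X → ℝ` extends continuously. As `ℝ` is
regular and `X` is dense in `βX`, these are the points `p` at which every continuous `f : X → ℝ`
has a limit along (the trace on `X` of) the neighbourhoods of `p`. -/
def hewittSet (X : Type*) [TopologicalSpace X] : Set (StoneCech X) :=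
  {p | ∀ f : X → ℝ, Continuous f →
    ∃ r : ℝ, Filter.Tendsto f (Filter.comap stoneCechUnit (nhds p)) (nhds r)}

/-- The set `(βX ∖ X) ∖ cl_{βX}(βX ∖ υX)`, where `X` is identified with its image in `βX`. -/
def outgrowthPart (X : Type*) [TopologicalSpace X] : Set (StoneCech X) :=
  (Set.range (stoneCechUnit : X → StoneCech X))ᶜ \ closure (hewittSet X)ᶜ

/-- An extension of `X`: a completely regular Hausdorff space together with a dense embedding of
`X` into it. An extension with compact remainder is a continuous image of a subspace of `βX`, so
nothing is lost by keeping the universe of `X`. -/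
structure SpaceExtension.{u} (X : Type u) [TopologicalSpace X] : Type (u + 1) where
  carrier : Type u
  [top : TopologicalSpace carrier]
  [t35 : T35Space carrier]
  emb : X → carrier
  isDenseEmbedding : IsDenseEmbedding emb

namespace SpaceExtension

attribute [instance] SpaceExtension.top SpaceExtension.t35

universe u

variable {X : Type u} [TopologicalSpace X]

/-- `E.Below F`: there is a continuous map from `F` to `E` that fixes `X` pointwise. -/
def Below (E F : SpaceExtension X) : Prop :=
  ∃ g : F.carrier → E.carrier, Continuous g ∧ ∀ x, g (F.emb x) = E.emb x

/-- Two extensions are equivalent if there is a homeomorphism that fixes `X` pointwise. -/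
def Equivalent (E F : SpaceExtension X) : Prop :=
  ∃ h : E.carrier ≃ₜ F.carrier, ∀ x, h (E.emb x) = F.emb x

/-- The remainder of `E` (the complement of `X` in `E`) is compact. -/
def HasCompactRemainder (E : SpaceExtension X) : Prop :=
  IsCompact (Set.range E.emb)ᶜ

theorem Below.refl (E : SpaceExtension X) : E.Below E :=
  ⟨id, continuous_id, fun _ => rfl⟩

theorem Below.trans {E F G : SpaceExtension X} (h₁ : E.Below F) (h₂ : F.Below G) :
    E.Below G := by
  obtain ⟨f, hf, hfx⟩ := h₁
  obtain ⟨g, hg, hgx⟩ := h₂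
  exact ⟨f ∘ g, hf.comp hg, fun x => by simp [hgx, hfx]⟩

theorem Equivalent.symm {E F : SpaceExtension X} (h : E.Equivalent F) : F.Equivalent E := by
  obtain ⟨h, hx⟩ := h
  exact ⟨h.symm, fun x => by rw [← hx x, h.symm_apply_apply]⟩

theorem Equivalent.below {E F : SpaceExtension X} (h : E.Equivalent F) : F.Below E := by
  obtain ⟨h, hx⟩ := h
  exact ⟨h, h.continuous, hx⟩

theorem Below.antisymm {E F : SpaceExtension X} (h₁ : E.Below F) (h₂ : F.Below E) :
    E.Equivalent F := by
  obtain ⟨f, hf, hfx⟩ := h₁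
  obtain ⟨g, hg, hgx⟩ := h₂
  have hfg : f ∘ g = id := E.isDenseEmbedding.dense.equalizer (hf.comp hg) continuous_id
    (funext fun x => by simp [hgx, hfx])
  have hgf : g ∘ f = id := F.isDenseEmbedding.dense.equalizer (hg.comp hf) continuous_id
    (funext fun x => by simp [hgx, hfx])
  exact ⟨{ toFun := g, invFun := f, left_inv := congrFun hfg, right_inv := congrFun hgf,
           continuous_toFun := hg, continuous_invFun := hf }, hgx⟩

/-- Equivalence of extensions of `X`. -/
instance setoid (X : Type u) [TopologicalSpace X] : Setoid (SpaceExtension X) where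
  r := Equivalent
  iseqv :=
    { refl := fun E => (Below.refl E).antisymm (Below.refl E)
      symm := fun h => h.symm
      trans := fun h₁ h₂ =>
        (h₁.symm.below.trans h₂.symm.below).antisymm (h₂.below.trans h₁.below) }

end SpaceExtension

/-- The equivalence classes of extensions of `X`. -/
def ExtensionClass.{u} (X : Type u) [TopologicalSpace X] : Type (u + 1) :=
  Quotient (SpaceExtension.setoid X)

/-- The class of `E` is below the class of `F` if there is a continuous map from `F` to `E` that
fixes `X` pointwise. -/
instance ExtensionClass.partialOrder.{u} (X : Type u) [TopologicalSpace X] :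
    PartialOrder (ExtensionClass X) where
  le := Quotient.lift₂ SpaceExtension.Below fun _ _ _ _ h₁ h₂ => propext
    ⟨fun h => h₁.below.trans (h.trans h₂.symm.below),
      fun h => h₁.symm.below.trans (h.trans h₂.below)⟩
  le_refl := by
    rintro ⟨E⟩
    exact SpaceExtension.Below.refl E
  le_trans := by
    rintro ⟨E⟩ ⟨F⟩ ⟨G⟩ h₁ h₂
    exact SpaceExtension.Below.trans h₁ h₂
  le_antisymm := by
    rintro ⟨E⟩ ⟨F⟩ h₁ h₂
    exact Quotient.sound (SpaceExtension.Below.antisymm h₁ h₂)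

/-- The set of all (equivalence classes of) pseudocompactifications of `X` with compact remainder,
with the order of `ExtensionClass X`. -/
def PseudocompactificationsCR.{u} (X : Type u) [TopologicalSpace X] : Set (ExtensionClass X) :=
  {c | ∃ E : SpaceExtension X, Quotient.mk (SpaceExtension.setoid X) E = c ∧
    IsPseudocompactSpace E.carrier ∧ E.HasCompactRemainder}

/-! Write `A` for the closure of βX ∖ υX and `B` for βX ∖ X; `B` is closed because X, being locally
compact, is open in βX. An extension T with compact remainder is determined by how βX → βT glues the
points lying over the remainder, that is, by a closed partial equivalence relation on βX with domain
inside `B`. T is pseudocompact exactly when this domain contains `A`, and larger extensions have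
smaller relations. So 𝒰(X) is dual to `ClosedPER A B` (`nonempty_orderIso_closedPER`).

It remains to read `B \ A` off this order. The least element is equality on `A`. Some atoms adjoin
one point of `B \ A`, others glue two points of `A`. Only the first kind can be the sole atom below
something strictly larger (`isLonelyAtom_iff`): an adjoined point may also be glued to a point of
`A`, whereas any further gluing inside `A` creates a further atom. Here `A` must be nonempty, which
is what non-pseudocompactness provides. The closed sets of `B \ A` are the domains of the relations,
and membership of a point in a domain is comparison with its atom; hence the topology is recovered
too (`nonempty_homeomorph`). -/

open Set Topology Filter

universe u

/-! ### Closed partial equivalence relations with domain between two sets -/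

section ClosedPartialEquivalences

variable {Z : Type*}

/-- The equality relation on `C`, with the points `x` and `y` identified. -/
def identifyRel (C : Set Z) (x y : Z) : Set (Z × Z) :=
  C ×ˢ C ∩ (diagonal Z ∪ {x, y} ×ˢ {x, y})

theorem mem_identifyRel_self {C : Set Z} {x y z : Z} : (z, z) ∈ identifyRel C x y ↔ z ∈ C := by
  simp [identifyRel]

variable [TopologicalSpace Z]

/-- `R` is a closed partial equivalence relation on `Z` whose domain contains `A` and is
contained in `B`. -/
def IsClosedPER (A B : Set Z) (R : Set (Z × Z)) : Prop :=
  IsClosed R ∧ (∀ x y, (x, y) ∈ R → (y, x) ∈ R) ∧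
    (∀ x y z, (x, y) ∈ R → (y, z) ∈ R → (x, z) ∈ R) ∧
    (∀ x ∈ A, (x, x) ∈ R) ∧ ∀ x, (x, x) ∈ R → x ∈ B

/-- The set of closed partial equivalence relations on `Z` whose domain contains `A` and is
contained in `B`, ordered by inclusion. -/
abbrev ClosedPER (A B : Set Z) : Type _ := {R : Set (Z × Z) // IsClosedPER A B R}

theorem isClosed_insert_of_isClosed [T1Space Z] {A : Set Z} (hA : IsClosed A) (p : Z) :
    IsClosed (insert p A) := by
  rw [insert_eq]
  exact isClosed_singleton.union hA

theorem identifyRel_isClosedPER [T2Space Z] {A B C : Set Z} (hC : IsClosed C) (hAC : A ⊆ C)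
    (hCB : C ⊆ B) (x y : Z) : IsClosedPER A B (identifyRel C x y) := by
  refine ⟨(hC.prod hC).inter (isClosed_diagonal.union
    ((toFinite _).isClosed.prod (toFinite _).isClosed)), ?_, ?_,
    fun z hz => mem_identifyRel_self.2 (hAC hz), fun z hz => hCB (mem_identifyRel_self.1 hz)⟩
  · simp only [identifyRel, mem_inter_iff, mem_prod, mem_union, mem_diagonal_iff]
    rintro u v ⟨⟨hu, hv⟩, rfl | ⟨h1, h2⟩⟩
    · exact ⟨⟨hv, hu⟩, Or.inl rfl⟩
    · exact ⟨⟨hv, hu⟩, Or.inr ⟨h2, h1⟩⟩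
  · simp only [identifyRel, mem_inter_iff, mem_prod, mem_union, mem_diagonal_iff]
    rintro u v w ⟨⟨hu, hv⟩, h⟩ ⟨⟨-, hw⟩, h'⟩
    refine ⟨⟨hu, hw⟩, ?_⟩
    rcases h with rfl | ⟨h1, h2⟩
    · exact h'
    · rcases h' with rfl | ⟨h3, h4⟩
      · exact Or.inr ⟨h1, h2⟩
      · exact Or.inr ⟨h1, h4⟩

namespace ClosedPER

variable {A B : Set Z}

theorem refl_left (R : ClosedPER A B) {x y : Z} (h : (x, y) ∈ R.1) : (x, x) ∈ R.1 :=
  R.2.2.2.1 _ _ _ h (R.2.2.1 _ _ h)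

theorem refl_right (R : ClosedPER A B) {x y : Z} (h : (x, y) ∈ R.1) : (y, y) ∈ R.1 :=
  R.2.2.2.1 _ _ _ (R.2.2.1 _ _ h) h

theorem identifyRel_subset (R : ClosedPER A B) {C : Set Z} (hC : ∀ z ∈ C, (z, z) ∈ R.1) {x y : Z}
    (h : (x, y) ∈ R.1) : identifyRel C x y ⊆ R.1 := by
  rintro ⟨u, v⟩ ⟨⟨hu, hv⟩, huv⟩
  rcases huv with huv | ⟨h1, h2⟩
  · obtain rfl : u = v := huv
    exact hC _ hu
  · have := R.refl_left h
    have := R.refl_right h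
    have := R.2.2.1 _ _ h
    simp only [mem_insert_iff, mem_singleton_iff] at h1 h2
    rcases h1 with rfl | rfl <;> rcases h2 with rfl | rfl <;> assumption

/-- The domain of a closed partial equivalence relation, as a subset of `B \ A`. -/
def points (R : ClosedPER A B) : Set ↥(B \ A) := {p | (p.1, p.1) ∈ R.1}

theorem points_subset {R S : ClosedPER A B} (h : R ≤ S) : R.points ⊆ S.points := fun _ hp => h hp

theorem isClosed_points (R : ClosedPER A B) : IsClosed R.points :=
  R.2.1.preimage (continuous_subtype_val.prodMk continuous_subtype_val)

variable [T2Space Z]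

/-- The least closed partial equivalence relation whose domain contains `p`. -/
def ofPoint (hA : IsClosed A) (hAB : A ⊆ B) (p : ↥(B \ A)) : ClosedPER A B :=
  ⟨identifyRel (insert p.1 A) p.1 p.1, identifyRel_isClosedPER (isClosed_insert_of_isClosed hA _)
    (subset_insert _ _) (insert_subset p.2.1 hAB) _ _⟩

theorem ofPoint_le_iff (hA : IsClosed A) (hAB : A ⊆ B) (p : ↥(B \ A)) (R : ClosedPER A B) :
    ofPoint hA hAB p ≤ R ↔ p ∈ R.points := by
  refine ⟨fun h => h (mem_identifyRel_self.2 (mem_insert _ _)), fun h => ?_⟩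
  refine identifyRel_subset R ?_ h
  rintro z (rfl | hz)
  · exact h
  · exact R.2.2.2.2.1 _ hz

theorem mem_points_ofPoint (hA : IsClosed A) (hAB : A ⊆ B) {p q : ↥(B \ A)} :
    q ∈ (ofPoint hA hAB p).points ↔ q = p := by
  change (q.1, q.1) ∈ identifyRel _ _ _ ↔ _
  rw [mem_identifyRel_self, mem_insert_iff, or_iff_left q.2.2, Subtype.ext_iff]

theorem ofPoint_injective (hA : IsClosed A) (hAB : A ⊆ B) :
    Function.Injective (ofPoint hA hAB) := fun p q h => by
  rw [← mem_points_ofPoint hA hAB, ← h, mem_points_ofPoint]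

theorem exists_points_eq (hA : IsClosed A) (hB : IsClosed B) (hAB : A ⊆ B) (hne : A.Nonempty)
    {S : Set ↥(B \ A)} (hS : IsClosed S) : ∃ R : ClosedPER A B, R.points = S := by
  obtain ⟨T, hT, rfl⟩ := isClosed_induced_iff.1 hS
  obtain ⟨w, -⟩ := hne
  -- Gluing `w` to itself does nothing: this is plain equality on the chosen closed domain.
  refine ⟨⟨identifyRel (T ∩ B ∪ A) w w, identifyRel_isClosedPER ((hT.inter hB).union hA)
    subset_union_right (union_subset inter_subset_right hAB) _ _⟩, ?_⟩
  ext p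
  change (p.1, p.1) ∈ identifyRel _ _ _ ↔ p.1 ∈ T
  rw [mem_identifyRel_self, mem_union, or_iff_left p.2.2, mem_inter_iff, and_iff_left p.2.1]

/-- The equality relation on `A`, with the points `x` and `y` identified. -/
def ofPair (hA : IsClosed A) (hAB : A ⊆ B) (x y : Z) : ClosedPER A B :=
  ⟨identifyRel A x y, identifyRel_isClosedPER hA subset_rfl hAB _ _⟩

theorem ofPair_le (hA : IsClosed A) (hAB : A ⊆ B) {x y : Z} {R : ClosedPER A B}
    (h : (x, y) ∈ R.1) : ofPair hA hAB x y ≤ R :=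
  identifyRel_subset R R.2.2.2.2.1 h

theorem isBot_ofPair (hA : IsClosed A) (hAB : A ⊆ B) {x : Z} (hx : x ∈ A) :
    IsBot (ofPair hA hAB x x) := fun R => ofPair_le hA hAB (R.2.2.2.2.1 x hx)

theorem eq_of_mem_ofPair (hA : IsClosed A) (hAB : A ⊆ B) {x u v : Z}
    (h : (u, v) ∈ (ofPair hA hAB x x).1) : u = v := by
  obtain ⟨-, h | ⟨h1, h2⟩⟩ := h
  · exact h
  · simp only [mem_insert_iff, mem_singleton_iff, or_self] at h1 h2
    rw [h1, h2]

theorem le_ofPair_self (hA : IsClosed A) (hAB : A ⊆ B) (x : Z) {R : ClosedPER A B}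
    (hR : R.points = ∅) (h : ∀ u v, (u, v) ∈ R.1 → u = v) : R ≤ ofPair hA hAB x x := by
  rintro ⟨u, v⟩ huv
  obtain rfl := h u v huv
  refine mem_identifyRel_self.2 (by_contra fun hu => ?_)
  exact (eq_empty_iff_forall_notMem.1 hR) ⟨u, R.2.2.2.2.2 u huv, hu⟩ huv

end ClosedPER
end ClosedPartialEquivalences

/-! ### Atoms in a partial order -/

section Order

variable {α β : Type*} [PartialOrder α] [PartialOrder β]

/-- The element `a` covers a least element. -/
def CoversBot (a : α) : Prop := ∃ b, IsBot b ∧ b ⋖ a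

/-- The element `a` covers a least element, and it is the only such element below some element
that is strictly larger. -/
def IsLonelyAtom (a : α) : Prop :=
  CoversBot a ∧ ∃ r, a < r ∧ ∀ c, CoversBot c → c ≤ r → c = a

theorem CoversBot.map (e : α ≃o β) {a : α} (h : CoversBot a) : CoversBot (e a) := by
  obtain ⟨b, hb, hab⟩ := h
  refine ⟨e b, fun c => ?_, (apply_covBy_apply_iff e).2 hab⟩
  rw [← e.le_symm_apply]
  exact hb _

theorem IsLonelyAtom.map (e : α ≃o β) {a : α} (h : IsLonelyAtom a) : IsLonelyAtom (e a) := by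
  obtain ⟨ha, r, har, hr⟩ := h
  refine ⟨ha.map e, e r, e.lt_iff_lt.2 har, fun c hc hcr => ?_⟩
  rw [← hr (e.symm c) (hc.map e.symm) (e.symm_apply_le.2 hcr), e.apply_symm_apply]

theorem CoversBot.eq_of_le {a c : α} (ha : CoversBot a) (hc : CoversBot c) (h : c ≤ a) :
    c = a := by
  obtain ⟨b, hb, hab⟩ := ha
  obtain ⟨d, hd, hcd⟩ := hc
  exact h.eq_of_not_lt fun hlt => hab.2 ((hb d).trans_lt hcd.lt) hlt

theorem CoversBot.not_le {a b : α} (ha : CoversBot a) (hb : IsBot b) : ¬ a ≤ b := by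
  obtain ⟨d, hd, hda⟩ := ha
  exact fun h => hda.lt.not_ge (h.trans (hb d))

theorem IsBot.coversBot {a b : α} (hb : IsBot b) (hab : ¬ a ≤ b)
    (h : ∀ r, r ≤ a → r ≤ b ∨ a ≤ r) : CoversBot a :=
  ⟨b, hb, ⟨(hb a).lt_of_not_ge hab, fun r hr hra =>
    (h r hra.le).elim hr.not_ge hra.not_ge⟩⟩

end Order

/-! ### Recovering `B \ A` from the order -/

namespace ClosedPER

variable {Z W : Type*} [TopologicalSpace Z] [TopologicalSpace W] [T2Space Z] [T2Space W]
  {A B : Set Z} {A' B' : Set W}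

theorem coversBot_ofPoint (hA : IsClosed A) (hAB : A ⊆ B) (hne : A.Nonempty) (p : ↥(B \ A)) :
    CoversBot (ofPoint hA hAB p) := by
  obtain ⟨a, ha⟩ := hne
  refine (isBot_ofPair hA hAB ha).coversBot ?_ fun R hR => ?_
  · rw [ofPoint_le_iff]
    exact fun h => p.2.2 (mem_identifyRel_self.1 h)
  · by_cases hp : p ∈ R.points
    · exact Or.inr ((ofPoint_le_iff hA hAB p R).2 hp)
    · refine Or.inl (le_ofPair_self hA hAB a ?_ ?_)
      · refine eq_empty_of_forall_notMem fun q hq => hp ?_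
        rwa [← (mem_points_ofPoint hA hAB).1 (points_subset hR hq)]
      · intro u v huv
        obtain ⟨-, h | ⟨h1, h2⟩⟩ := hR huv
        · exact h
        · simp only [mem_insert_iff, mem_singleton_iff, or_self] at h1 h2
          rw [h1, h2]

theorem coversBot_ofPair (hA : IsClosed A) (hAB : A ⊆ B) {x y : Z} (hx : x ∈ A) (hy : y ∈ A)
    (hxy : x ≠ y) : CoversBot (ofPair hA hAB x y) := by
  refine (isBot_ofPair hA hAB hx).coversBot ?_ fun R hR => ?_
  · exact fun h => hxy (eq_of_mem_ofPair hA hAB (h ⟨⟨hx, hy⟩, Or.inr ⟨by simp, by simp⟩⟩))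
  · by_cases hp : (x, y) ∈ R.1
    · exact Or.inr (ofPair_le hA hAB hp)
    · refine Or.inl (le_ofPair_self hA hAB x ?_ ?_)
      · exact eq_empty_of_forall_notMem fun q hq => q.2.2 (mem_identifyRel_self.1 (hR hq))
      · intro u v huv
        obtain ⟨-, h | ⟨h1, h2⟩⟩ := hR huv
        · exact h
        · simp only [mem_insert_iff, mem_singleton_iff] at h1 h2
          rcases h1 with rfl | rfl <;> rcases h2 with rfl | rfl
          · rfl
          · exact (hp huv).elim
          · exact (hp (R.2.2.1 _ _ huv)).elim
          · rfl

theorem isLonelyAtom_ofPoint (hA : IsClosed A) (hAB : A ⊆ B) (hne : A.Nonempty) (p : ↥(B \ A)) :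
    IsLonelyAtom (ofPoint hA hAB p) := by
  refine ⟨coversBot_ofPoint hA hAB hne p, ?_⟩
  obtain ⟨a, ha⟩ := hne
  -- The larger element adjoins `p` and glues it to a point `a` of `A`. A relation below it whose
  -- domain omits `p` has lost the gluing as well, so it is the least element.
  refine ⟨⟨identifyRel (insert p.1 A) p.1 a, identifyRel_isClosedPER (isClosed_insert_of_isClosed hA _)
    (subset_insert _ _) (insert_subset p.2.1 hAB) _ _⟩, lt_of_le_not_ge ?_ ?_, fun c hc hcr => ?_⟩
  · rw [ofPoint_le_iff]
    exact mem_identifyRel_self.2 (mem_insert _ _)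
  · intro h
    have h' : (p.1, a) ∈ (ofPoint hA hAB p).1 := h
      ⟨⟨mem_insert _ _, mem_insert_of_mem _ ha⟩, Or.inr ⟨by simp, by simp⟩⟩
    obtain ⟨-, h | ⟨-, h⟩⟩ := h'
    · exact p.2.2 ((show p.1 = a from h) ▸ ha)
    · simp only [mem_insert_iff, mem_singleton_iff, or_self] at h
      exact p.2.2 (h ▸ ha)
  · by_cases hp : p ∈ c.points
    · exact (hc.eq_of_le (coversBot_ofPoint hA hAB ⟨a, ha⟩ p)
        ((ofPoint_le_iff hA hAB p c).2 hp)).symm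
    · refine (hc.not_le (isBot_ofPair hA hAB ha) (le_ofPair_self hA hAB a ?_ ?_)).elim
      · refine eq_empty_of_forall_notMem fun q hq => hp ?_
        have hq' := mem_identifyRel_self.1 (hcr hq)
        rw [mem_insert_iff, or_iff_left q.2.2] at hq'
        rwa [← Subtype.ext hq']
      · intro u v huv
        have hup : u ≠ p.1 := by
          rintro rfl
          exact hp (c.refl_left huv)
        have hvp : v ≠ p.1 := by
          rintro rfl
          exact hp (c.refl_right huv)
        obtain ⟨-, h | ⟨h1, h2⟩⟩ := hcr huv
        · exact h
        · simp only [mem_insert_iff, mem_singleton_iff, hup, hvp, false_or] at h1 h2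
          rw [h1, h2]

/-- No classification of atoms is needed: if `a` is not a point atom, its witness `r` lives on `A`,
and any pair in `r` but not in `a` yields a gluing atom below `r` different from `a`. -/
theorem isLonelyAtom_iff (hA : IsClosed A) (hAB : A ⊆ B) (hne : A.Nonempty) {a : ClosedPER A B} :
    IsLonelyAtom a ↔ ∃ p, ofPoint hA hAB p = a := by
  refine ⟨fun ⟨ha, r, har, hr⟩ => ?_, ?_⟩
  · by_contra! hcon
    have hrp : r.points = ∅ := eq_empty_of_forall_notMem fun p hp =>
      hcon p (hr _ (coversBot_ofPoint hA hAB hne p) ((ofPoint_le_iff hA hAB p r).2 hp))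
    obtain ⟨⟨x, y⟩, hxy, hxy'⟩ := not_subset.1 har.not_ge
    have hrA : ∀ u, (u, u) ∈ r.1 → u ∈ A := fun u hu => by_contra fun huA =>
      eq_empty_iff_forall_notMem.1 hrp ⟨u, r.2.2.2.2.2 u hu, huA⟩ hu
    have hx := hrA x (r.refl_left hxy)
    have hy := hrA y (r.refl_right hxy)
    have hne' : x ≠ y := by
      rintro rfl
      exact hxy' (a.2.2.2.2.1 x hx)
    rw [← hr _ (coversBot_ofPair hA hAB hx hy hne') (ofPair_le hA hAB hxy)] at hxy'
    exact hxy' ⟨⟨hx, hy⟩, Or.inr ⟨by simp, by simp⟩⟩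
  · rintro ⟨p, rfl⟩
    exact isLonelyAtom_ofPoint hA hAB hne p

/-- The isomorphism permutes lonely atoms, hence points. It preserves closed sets because `p ∈
R.points` means `ofPoint p ≤ R`, and every closed set is some `R.points`. -/
theorem nonempty_homeomorph (hA : IsClosed A) (hB : IsClosed B) (hAB : A ⊆ B) (hne : A.Nonempty)
    (hA' : IsClosed A') (hB' : IsClosed B') (hAB' : A' ⊆ B') (hne' : A'.Nonempty)
    (e : ClosedPER A B ≃o ClosedPER A' B') : Nonempty (↥(B \ A) ≃ₜ ↥(B' \ A')) := by
  choose f hf using fun p => (isLonelyAtom_iff hA' hAB' hne').1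
    ((isLonelyAtom_ofPoint hA hAB hne p).map e)
  choose g hg using fun p => (isLonelyAtom_iff hA hAB hne).1
    ((isLonelyAtom_ofPoint hA' hAB' hne' p).map e.symm)
  have hgf : ∀ p, g (f p) = p := fun p => ofPoint_injective hA hAB (by
    rw [hg, hf, e.symm_apply_apply])
  have hfg : ∀ p, f (g p) = p := fun p => ofPoint_injective hA' hAB' (by
    rw [hf, hg, e.apply_symm_apply])
  have hfc : Continuous f := continuous_iff_isClosed.2 fun S hS => by
    obtain ⟨R, rfl⟩ := exists_points_eq hA' hB' hAB' hne' hS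
    convert isClosed_points (e.symm R) using 1
    ext p
    rw [mem_preimage, ← ofPoint_le_iff hA' hAB', ← ofPoint_le_iff hA hAB, hf, e.le_symm_apply]
  have hgc : Continuous g := continuous_iff_isClosed.2 fun S hS => by
    obtain ⟨R, rfl⟩ := exists_points_eq hA hB hAB hne hS
    convert isClosed_points (e R) using 1
    ext p
    rw [mem_preimage, ← ofPoint_le_iff hA' hAB', ← ofPoint_le_iff hA hAB, hg, e.symm_apply_le]
  exact ⟨⟨⟨f, g, hgf, hfg⟩, hfc, hgc⟩⟩

end ClosedPER

/-! ### Quotients of compact Hausdorff spaces by closed equivalence relations -/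

section Quotients

variable {Z : Type*} [TopologicalSpace Z] [CompactSpace Z] [T2Space Z]

/-- The saturation of a closed set is the projection of a compact part of the relation. -/
theorem isClosedMap_quotientMk {S : Setoid Z} (hS : IsClosed {z : Z × Z | S z.1 z.2}) :
    IsClosedMap (Quotient.mk S) := by
  intro F hF
  refine isQuotientMap_quot_mk.isClosed_preimage.1 ?_
  have h : IsClosed (Prod.snd '' ({z : Z × Z | S z.1 z.2} ∩ Prod.fst ⁻¹' F)) :=
    ((hS.inter (hF.preimage continuous_fst)).isCompact.image continuous_snd).isClosed
  convert h using 1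
  ext y
  constructor
  · rintro ⟨x, hx, hxy⟩
    exact ⟨(x, y), ⟨Quotient.exact hxy, hx⟩, rfl⟩
  · rintro ⟨⟨x, y⟩, ⟨hxy, hx⟩, rfl⟩
    exact ⟨x, hx, Quotient.sound hxy⟩

theorem t2Space_quotient_of_isClosed {S : Setoid Z} (hS : IsClosed {z : Z × Z | S z.1 z.2}) :
    T2Space (Quotient S) := by
  have hq := isClosedMap_quotientMk hS
  have hc : Continuous (Quotient.mk S) := continuous_quot_mk
  have hfib : ∀ x, IsClosed (Quotient.mk S ⁻¹' {Quotient.mk S x}) := fun x => by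
    have := hq _ (isClosed_singleton (x := x))
    rw [image_singleton] at this
    exact this.preimage hc
  refine ⟨fun a b hab => ?_⟩
  obtain ⟨x, rfl⟩ := Quotient.exists_rep a
  obtain ⟨y, rfl⟩ := Quotient.exists_rep b
  obtain ⟨U, V, hU, hV, hxU, hyV, hUV⟩ := normal_separation (hfib x) (hfib y)
    (Disjoint.preimage _ (disjoint_singleton.2 hab))
  -- The separating sets consist of the classes lying entirely in `U`, respectively in `V`.
  refine ⟨_, _, (hq _ hU.isClosed_compl).isOpen_compl, (hq _ hV.isClosed_compl).isOpen_compl,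
    ?_, ?_, ?_⟩
  · rintro ⟨z, hz, hzx⟩
    exact hz (hxU hzx)
  · rintro ⟨z, hz, hzy⟩
    exact hz (hyV hzy)
  · rw [Set.disjoint_left]
    intro c h1 h2
    obtain ⟨z, rfl⟩ := Quotient.exists_rep c
    have hzU : z ∈ U := by_contra fun h => h1 ⟨z, h, rfl⟩
    have hzV : z ∈ V := by_contra fun h => h2 ⟨z, h, rfl⟩
    exact Set.disjoint_left.1 hUV hzU hzV

end Quotients

/-! ### X and υX inside βX -/

section StoneCechCompactification

variable {X : Type u} [TopologicalSpace X]

theorem comap_stoneCechUnit_nhds_neBot (p : StoneCech X) :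
    (comap stoneCechUnit (𝓝 p)).NeBot :=
  comap_neBot_iff.2 fun t ht => by
    obtain ⟨_, hy, x, rfl⟩ := mem_closure_iff_nhds.1 (denseRange_stoneCechUnit p) t ht
    exact ⟨x, hy⟩

theorem isOpenEmbedding_stoneCechUnit [T35Space X] [LocallyCompactSpace X] :
    IsOpenEmbedding (stoneCechUnit : X → StoneCech X) := by
  refine ⟨isEmbedding_stoneCechUnit, isOpen_iff_mem_nhds.2 ?_⟩
  rintro _ ⟨x, rfl⟩
  obtain ⟨K, hK, hxK⟩ := exists_compact_mem_nhds x
  rw [isInducing_stoneCechUnit.nhds_eq_comap, mem_comap] at hxK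
  obtain ⟨V, hV, hVK⟩ := hxK
  obtain ⟨U, hUV, hU, hxU⟩ := mem_nhds_iff.1 hV
  refine mem_of_superset (hU.mem_nhds hxU) ?_
  refine (denseRange_stoneCechUnit.open_subset_closure_inter hU).trans ?_
  refine (closure_minimal ?_ (hK.image continuous_stoneCechUnit).isClosed).trans
    (image_subset_range stoneCechUnit K)
  rintro _ ⟨hy, y, rfl⟩
  exact ⟨y, hVK (hUV hy), rfl⟩

theorem range_stoneCechUnit_subset_hewittSet [CompletelyRegularSpace X] :
    range stoneCechUnit ⊆ hewittSet X := by
  rintro _ ⟨x, rfl⟩ f hf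
  refine ⟨f x, ?_⟩
  rw [← isInducing_stoneCechUnit.nhds_eq_comap]
  exact hf.tendsto x

theorem closure_compl_hewittSet_subset [T35Space X] [LocallyCompactSpace X] :
    closure (hewittSet X)ᶜ ⊆ (range stoneCechUnit)ᶜ :=
  closure_minimal (compl_subset_compl.2 range_stoneCechUnit_subset_hewittSet)
    isOpenEmbedding_stoneCechUnit.isOpen_range.isClosed_compl

/-- Along an ultrafilter on which `|f|` tends to infinity, the limit in `βX` is outside `υX`. -/
theorem exists_ultrafilter_of_unbounded {f : X → ℝ} (hf : Continuous f)
    (h : ∀ C, ∃ x, C < |f x|) : ∃ (u : Ultrafilter X) (p : StoneCech X),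
      Tendsto (fun x => |f x|) u atTop ∧ Tendsto stoneCechUnit u (𝓝 p) ∧ p ∉ hewittSet X := by
  have hne : (comap (fun x => |f x|) atTop).NeBot := comap_neBot_iff.2 fun t ht => by
    obtain ⟨C, hC⟩ := mem_atTop_sets.1 ht
    obtain ⟨x, hx⟩ := h C
    exact ⟨x, hC _ hx.le⟩
  have hu : Tendsto (fun x => |f x|) (Ultrafilter.of (comap (fun x => |f x|) atTop)) atTop :=
    tendsto_comap.mono_left (Ultrafilter.of_le _)
  refine ⟨Ultrafilter.of (comap (fun x => |f x|) atTop), _, hu,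
    Ultrafilter.le_nhds_lim (Ultrafilter.map stoneCechUnit _), fun hp => ?_⟩
  obtain ⟨r, hr⟩ := hp f hf
  refine not_tendsto_nhds_of_tendsto_atTop hu |r| ((hr.mono_left ?_).abs)
  exact map_le_iff_le_comap.1 (Ultrafilter.le_nhds_lim (Ultrafilter.map stoneCechUnit _))

theorem nonempty_compl_hewittSet (hX : ¬ IsPseudocompactSpace X) : (hewittSet X)ᶜ.Nonempty := by
  simp only [IsPseudocompactSpace, not_forall, not_exists, not_le] at hX
  obtain ⟨f, hf, h⟩ := hX
  obtain ⟨-, p, -, -, hp⟩ := exists_ultrafilter_of_unbounded hf h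
  exact ⟨p, hp⟩

/-- A function without a limit at `p` is unbounded near `p`: if it were bounded there, a truncation
would agree with it near `p` and extend to βX. -/
theorem exists_unbounded_of_notMem_hewittSet {p : StoneCech X} (hp : p ∉ hewittSet X) :
    ∃ f : X → ℝ, Continuous f ∧ ∀ U ∈ 𝓝 p, ∀ C, ∃ x, stoneCechUnit x ∈ U ∧ C < |f x| := by
  simp only [hewittSet, mem_ofPred_eq, not_forall] at hp
  obtain ⟨f, hf, h⟩ := hp
  refine ⟨f, hf, fun U hU C => by_contra fun hcon => h ?_⟩
  push Not at hcon
  have hne := comap_stoneCechUnit_nhds_neBot p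
  have hev : ∀ᶠ x in comap stoneCechUnit (𝓝 p), |f x| ≤ C :=
    mem_of_superset (preimage_mem_comap hU) hcon
  obtain ⟨x, hx⟩ := hev.exists
  have hC : -C ≤ C := neg_le_self ((abs_nonneg _).trans hx)
  have hg : Continuous (fun x => projIcc (-C) C hC (f x)) := continuous_projIcc.comp hf
  refine ⟨(stoneCechExtend hg p : Icc (-C) C), ?_⟩
  have ht : Tendsto (fun x => ((stoneCechExtend hg (stoneCechUnit x) : Icc (-C) C) : ℝ))
      (comap stoneCechUnit (𝓝 p)) (𝓝 ((stoneCechExtend hg p : Icc (-C) C) : ℝ)) :=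
    ((continuous_subtype_val.comp (continuous_stoneCechExtend hg)).tendsto p).comp tendsto_comap
  refine ht.congr' ?_
  filter_upwards [hev] with x hx
  rw [stoneCechExtend_stoneCechUnit, projIcc_of_mem hC (abs_le.1 hx)]

end StoneCechCompactification

/-! ### From extensions to relations on βX -/

namespace SpaceExtension

variable {X : Type u} [TopologicalSpace X] (E F : SpaceExtension X)

theorem continuous_stoneCechUnit_emb : Continuous (stoneCechUnit ∘ E.emb) :=
  continuous_stoneCechUnit.comp E.isDenseEmbedding.continuous

/-- The continuous extension `βX → βT` of the inclusion of `X` into the extension `T`. -/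
noncomputable def stoneCechMap : StoneCech X → StoneCech E.carrier :=
  stoneCechExtend E.continuous_stoneCechUnit_emb

theorem continuous_stoneCechMap : Continuous E.stoneCechMap :=
  continuous_stoneCechExtend _

theorem stoneCechMap_unit (x : X) :
    E.stoneCechMap (stoneCechUnit x) = stoneCechUnit (E.emb x) :=
  stoneCechExtend_stoneCechUnit _ x

theorem stoneCechMap_surjective : Function.Surjective E.stoneCechMap := by
  rw [← range_eq_univ, ← (isCompact_range E.continuous_stoneCechMap).isClosed.closure_eq]
  refine dense_iff_closure_eq.1 ((denseRange_stoneCechUnit.comp E.isDenseEmbedding.dense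
    continuous_stoneCechUnit).mono ?_)
  rintro _ ⟨x, rfl⟩
  exact ⟨stoneCechUnit x, E.stoneCechMap_unit x⟩

/-- The partial equivalence relation on `βX` that identifies the points with the same image in the
remainder of the extension. -/
def remainderRel : Set (StoneCech X × StoneCech X) :=
  {z | E.stoneCechMap z.1 = E.stoneCechMap z.2 ∧
    E.stoneCechMap z.1 ∈ stoneCechUnit '' (range E.emb)ᶜ}

theorem mem_remainderRel_self {p : StoneCech X} :
    (p, p) ∈ E.remainderRel ↔ E.stoneCechMap p ∈ stoneCechUnit '' (range E.emb)ᶜ := by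
  simp [remainderRel]

/-- X embeds in βT, so a trace filter converging to a point of X in βT already converges in X. Thus
βX → βT sends no new point into X. -/
theorem eq_unit_of_stoneCechMap_eq [CompletelyRegularSpace X] {p : StoneCech X} {x : X}
    (h : E.stoneCechMap p = stoneCechUnit (E.emb x)) : p = stoneCechUnit x := by
  have hne := comap_stoneCechUnit_nhds_neBot p
  have h1 : Tendsto (stoneCechUnit ∘ E.emb) (comap stoneCechUnit (𝓝 p))
      (𝓝 (stoneCechUnit (E.emb x))) := by
    rw [← h]
    exact ((E.continuous_stoneCechMap.tendsto p).comp tendsto_comap).congr E.stoneCechMap_unit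
  have h2 : Tendsto id (comap stoneCechUnit (𝓝 p)) (𝓝 x) :=
    (isInducing_stoneCechUnit.comp E.isDenseEmbedding.isInducing).tendsto_nhds_iff.2 h1
  have h3 : Tendsto stoneCechUnit (comap stoneCechUnit (𝓝 p)) (𝓝 (stoneCechUnit x)) :=
    (continuous_stoneCechUnit.tendsto x).comp h2
  exact tendsto_nhds_unique tendsto_comap h3

theorem below_iff_remainderRel_subset [CompletelyRegularSpace X] :
    E.Below F ↔ F.remainderRel ⊆ E.remainderRel := by
  constructor
  · rintro ⟨f, hf, hfx⟩ ⟨p, q⟩ ⟨hpq, t, ht, htp⟩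
    have hc : Continuous (stoneCechUnit ∘ f) := continuous_stoneCechUnit.comp hf
    have hcomp : stoneCechExtend hc ∘ F.stoneCechMap = E.stoneCechMap :=
      stoneCech_hom_ext ((continuous_stoneCechExtend hc).comp F.continuous_stoneCechMap)
        E.continuous_stoneCechMap (funext fun x => by
          simp [stoneCechMap_unit, stoneCechExtend_stoneCechUnit, hfx])
    simp only at htp hpq
    refine ⟨?_, f t, ?_, ?_⟩
    · simp only [← hcomp, Function.comp_apply, hpq]
    -- `f` maps remainder to remainder: were `f t` in X, then `p`, and with it `t`, would be in X.
    · rintro ⟨x, hx⟩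
      have hp : p = stoneCechUnit x := E.eq_unit_of_stoneCechMap_eq (by
        rw [← hcomp, Function.comp_apply, ← htp, stoneCechExtend_stoneCechUnit,
          Function.comp_apply, hx])
      rw [hp, stoneCechMap_unit] at htp
      exact ht ⟨x, (injective_stoneCechUnit_of_t35Space htp).symm⟩
    · simp only [← hcomp, Function.comp_apply, ← htp, stoneCechExtend_stoneCechUnit]
  · intro h
    have key : ∀ t : F.carrier, ∃ s : E.carrier, ∀ p, F.stoneCechMap p = stoneCechUnit t →
        E.stoneCechMap p = stoneCechUnit s := by
      intro t
      by_cases ht : t ∈ range F.emb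
      · obtain ⟨x, rfl⟩ := ht
        refine ⟨E.emb x, fun p hp => ?_⟩
        rw [F.eq_unit_of_stoneCechMap_eq hp, stoneCechMap_unit]
      · obtain ⟨p, hp⟩ := F.stoneCechMap_surjective (stoneCechUnit t)
        obtain ⟨s, -, hs⟩ := (E.mem_remainderRel_self).1
          (h (F.mem_remainderRel_self.2 ⟨t, ht, hp.symm⟩))
        refine ⟨s, fun q hq => ?_⟩
        have hpq : (p, q) ∈ F.remainderRel := ⟨hp.trans hq.symm, t, ht, hp.symm⟩
        rw [hs]
        exact (h hpq).1.symm
    choose f hf using key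
    refine ⟨f, continuous_iff_isClosed.2 fun S hS => ?_, fun x => ?_⟩
    · obtain ⟨S', hS', rfl⟩ := isInducing_stoneCechUnit.isClosed_iff.1 hS
      -- Preimages under `f` are computed by lifting to βX, and βX → βF is a closed map.
      have hcl : IsClosed (F.stoneCechMap '' (E.stoneCechMap ⁻¹' S')) :=
        F.continuous_stoneCechMap.isClosedMap _ (hS'.preimage E.continuous_stoneCechMap)
      convert hcl.preimage continuous_stoneCechUnit using 1
      ext t
      constructor
      · intro ht
        obtain ⟨p, hp⟩ := F.stoneCechMap_surjective (stoneCechUnit t)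
        refine ⟨p, ?_, hp⟩
        rw [mem_preimage, hf t p hp]
        exact ht
      · rintro ⟨p, hpS, hp⟩
        rw [mem_preimage, hf t p hp] at hpS
        exact hpS
    · refine injective_stoneCechUnit_of_t35Space ?_
      rw [← hf _ _ (F.stoneCechMap_unit x), stoneCechMap_unit]

variable {E}

theorem isClosed_image_remainder (hE : E.HasCompactRemainder) :
    IsClosed (stoneCechUnit '' (range E.emb)ᶜ) :=
  (IsCompact.image hE continuous_stoneCechUnit).isClosed

theorem isOpenEmbedding_emb (hE : E.HasCompactRemainder) : IsOpenEmbedding E.emb :=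
  ⟨E.isDenseEmbedding.isEmbedding, isClosed_compl_iff.1 (IsCompact.isClosed hE)⟩

/-- A function on `X` that vanishes near the remainder extends by zero. -/
theorem continuous_extend_zero (hE : E.HasCompactRemainder) {f : X → ℝ} (hf : Continuous f)
    {V : Set (StoneCech X)} (hV : IsOpen V)
    (hEV : E.stoneCechMap ⁻¹' (stoneCechUnit '' (range E.emb)ᶜ) ⊆ V)
    (hfV : ∀ x, stoneCechUnit x ∈ V → f x = 0) : Continuous (Function.extend E.emb f 0) := by
  have hinj := E.isDenseEmbedding.injective
  refine continuous_iff_continuousAt.2 fun t => ?_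
  by_cases ht : t ∈ range E.emb
  · obtain ⟨x, rfl⟩ := ht
    rw [← (isOpenEmbedding_emb hE).continuousAt_iff, Function.extend_comp hinj]
    exact hf.continuousAt
  -- The points of the extension not covered by `Vᶜ` form an open set around `t` on which the
  -- extended function vanishes.
  · have hW : IsOpen (stoneCechUnit ⁻¹' (E.stoneCechMap '' Vᶜ)ᶜ : Set E.carrier) :=
      (E.continuous_stoneCechMap.isClosedMap _ hV.isClosed_compl).isOpen_compl.preimage
        continuous_stoneCechUnit
    have htW : t ∈ (stoneCechUnit ⁻¹' (E.stoneCechMap '' Vᶜ)ᶜ : Set E.carrier) := by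
      rintro ⟨p, hp, hpt⟩
      exact hp (hEV ⟨t, ht, hpt.symm⟩)
    refine (continuousAt_const (y := (0 : ℝ))).congr ?_
    filter_upwards [hW.mem_nhds htW] with s hs
    by_cases hsX : s ∈ range E.emb
    · obtain ⟨x, rfl⟩ := hsX
      rw [hinj.extend_apply]
      refine (hfV x (by_contra fun hx => hs ⟨_, hx, E.stoneCechMap_unit x⟩)).symm
    · rw [Function.extend_apply' _ _ _ hsX, Pi.zero_apply]

/-- A point outside υX and not over the remainder would carry a function unbounded near it; cut off
near the remainder, that function extends by zero to an unbounded function on T. -/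
theorem compl_hewittSet_subset (hE : E.HasCompactRemainder) (hps : IsPseudocompactSpace E.carrier) :
    (hewittSet X)ᶜ ⊆ E.stoneCechMap ⁻¹' (stoneCechUnit '' (range E.emb)ᶜ) := by
  intro p hp
  by_contra hpC
  obtain ⟨f, hf, hunb⟩ := exists_unbounded_of_notMem_hewittSet hp
  obtain ⟨g, hg0, hg1, -⟩ := exists_continuous_zero_one_of_isClosed
    ((isClosed_image_remainder hE).preimage E.continuous_stoneCechMap)
    (isClosed_singleton (x := p)) (disjoint_singleton_right.2 hpC)
  -- Subtracting 1/2 makes the cutoff vanish on the open set `g < 1/2`, not merely where `g = 0`.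
  -- Where `g > 3/4` it is at least 1/4, whence the bound `4 * C` below.
  have hcont : Continuous fun x => f x * max (g (stoneCechUnit x) - 1 / 2) 0 :=
    hf.mul (((g.continuous.comp continuous_stoneCechUnit).sub continuous_const).max
      continuous_const)
  obtain ⟨C, hC⟩ := hps _ (continuous_extend_zero hE hcont
    (isOpen_lt g.continuous (continuous_const (y := (1 / 2 : ℝ)))) (fun q hq => by
      have := hg0 hq
      simp only [Pi.zero_apply] at this
      simp only [mem_ofPred_eq, this]
      norm_num) (fun x hx => by
      rw [max_eq_right (sub_nonpos.2 (le_of_lt hx)), mul_zero]))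
  have hpU : {q | 3 / 4 < g q} ∈ 𝓝 p := by
    refine (isOpen_lt continuous_const g.continuous).mem_nhds ?_
    have := hg1 (mem_singleton p)
    simp only [Pi.one_apply] at this
    simp only [mem_ofPred_eq, this]
    norm_num
  obtain ⟨x, hxU, hx⟩ := hunb _ hpU (4 * C)
  have hxC := hC (E.emb x)
  rw [E.isDenseEmbedding.injective.extend_apply, abs_mul,
    abs_of_nonneg (le_max_right (g (stoneCechUnit x) - 1 / 2) 0)] at hxC
  have h1 : (1 / 4 : ℝ) ≤ max (g (stoneCechUnit x) - 1 / 2) 0 := by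
    refine le_max_of_le_left ?_
    have : 3 / 4 < g (stoneCechUnit x) := hxU
    linarith
  have h2 := mul_le_mul_of_nonneg_left h1 (abs_nonneg (f x))
  linarith

theorem isClosedPER_remainderRel (hE : E.HasCompactRemainder)
    (hps : IsPseudocompactSpace E.carrier) :
    IsClosedPER (closure (hewittSet X)ᶜ) (range stoneCechUnit)ᶜ E.remainderRel := by
  have hcl := (isClosed_image_remainder hE).preimage E.continuous_stoneCechMap
  refine ⟨?_, ?_, ?_, ?_, ?_⟩
  · exact (isClosed_eq (E.continuous_stoneCechMap.comp continuous_fst)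
      (E.continuous_stoneCechMap.comp continuous_snd)).inter (hcl.preimage continuous_fst)
  · rintro p q ⟨h1, h2⟩
    exact ⟨h1.symm, h1 ▸ h2⟩
  · rintro p q r ⟨h1, h2⟩ ⟨h3, -⟩
    exact ⟨h1.trans h3, h2⟩
  · exact fun p hp => E.mem_remainderRel_self.2
      (closure_minimal (compl_hewittSet_subset hE hps) hcl hp)
  · rintro _ hp ⟨x, rfl⟩
    obtain ⟨t, ht, htx⟩ := E.mem_remainderRel_self.1 hp
    rw [stoneCechMap_unit] at htx
    exact ht ⟨x, (injective_stoneCechUnit_of_t35Space htx).symm⟩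

end SpaceExtension

/-! ### From relations on βX back to extensions -/

namespace ClosedPER

variable {X : Type u} [TopologicalSpace X]

/-- The equivalence relation obtained from a closed partial equivalence relation by adding all
pairs `(p, p)`. -/
def toSetoid {Z : Type*} [TopologicalSpace Z] {A B : Set Z} (R : ClosedPER A B) : Setoid Z where
  r p q := p = q ∨ (p, q) ∈ R.1
  iseqv :=
    { refl := fun _ => Or.inl rfl
      symm := by
        rintro p q (rfl | h)
        · exact Or.inl rfl
        · exact Or.inr (R.2.2.1 _ _ h)
      trans := by
        rintro p q r (rfl | h) (rfl | h')
        · exact Or.inl rfl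
        · exact Or.inr h'
        · exact Or.inr h
        · exact Or.inr (R.2.2.2.1 _ _ _ h h') }

theorem t2Space_quotient {Z : Type*} [TopologicalSpace Z] [CompactSpace Z] [T2Space Z]
    {A B : Set Z} (R : ClosedPER A B) : T2Space (Quotient R.toSetoid) :=
  t2Space_quotient_of_isClosed (isClosed_diagonal.union R.2.1)

variable {A : Set (StoneCech X)} (R : ClosedPER A (range stoneCechUnit)ᶜ)

instance : T2Space (Quotient R.toSetoid) := R.t2Space_quotient

/-- The quotient of the subspace of `βX` made of `X` and the domain of `R`. -/
abbrev ExtensionSpace : Type u :=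
  ↥(Quotient.mk R.toSetoid '' (range stoneCechUnit ∪ {p | (p, p) ∈ R.1}))

theorem eq_of_mk_unit_eq {x : X} {p : StoneCech X}
    (h : Quotient.mk R.toSetoid p = Quotient.mk R.toSetoid (stoneCechUnit x)) :
    p = stoneCechUnit x :=
  (Quotient.exact h).elim id fun h => (R.2.2.2.2.2 _ (R.refl_right h) ⟨x, rfl⟩).elim

/-- The inclusion of `X` into `ExtensionSpace R`. -/
def extensionEmb (x : X) : R.ExtensionSpace :=
  ⟨Quotient.mk _ (stoneCechUnit x), _, Or.inl ⟨x, rfl⟩, rfl⟩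

/-- The class of a point of the domain of `R`. -/
def extensionMk {p : StoneCech X} (hp : (p, p) ∈ R.1) : R.ExtensionSpace :=
  ⟨Quotient.mk _ p, _, Or.inr hp, rfl⟩

theorem extensionMk_notMem_range {p : StoneCech X} (hp : (p, p) ∈ R.1) :
    R.extensionMk hp ∉ range R.extensionEmb := by
  rintro ⟨x, hx⟩
  have h := R.eq_of_mk_unit_eq (congrArg Subtype.val hx).symm
  exact R.2.2.2.2.2 _ hp ⟨x, h.symm⟩

theorem exists_extensionMk_eq {t : R.ExtensionSpace} (ht : t ∉ range R.extensionEmb) :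
    ∃ (p : StoneCech X) (hp : (p, p) ∈ R.1), R.extensionMk hp = t := by
  obtain ⟨_, p, ⟨x, rfl⟩ | hp, rfl⟩ := t
  · exact (ht ⟨x, rfl⟩).elim
  · exact ⟨p, hp, rfl⟩

theorem continuous_quotientMk : Continuous (Quotient.mk R.toSetoid) := continuous_quot_mk

theorem tendsto_extensionEmb {p : StoneCech X} (hp : (p, p) ∈ R.1) {l : Filter X}
    (hl : Tendsto stoneCechUnit l (𝓝 p)) : Tendsto R.extensionEmb l (𝓝 (R.extensionMk hp)) :=
  tendsto_subtype_rng.2 ((R.continuous_quotientMk.tendsto p).comp hl)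

/-- Points of X are alone in their classes and X is open in βX, so X stays open and embedded in the
quotient. -/
theorem isDenseEmbedding_extensionEmb [T35Space X] [LocallyCompactSpace X] :
    IsDenseEmbedding R.extensionEmb := by
  have hunit := isOpenEmbedding_stoneCechUnit (X := X)
  have hc : Continuous (Quotient.mk R.toSetoid ∘ stoneCechUnit) :=
    R.continuous_quotientMk.comp hunit.continuous
  have hemb : IsOpenEmbedding (Quotient.mk R.toSetoid ∘ stoneCechUnit) := by
    refine .of_continuous_injective_isOpenMap hc (fun x y h => ?_) fun U hU => ?_
    · exact hunit.injective (R.eq_of_mk_unit_eq h)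
    · refine isQuotientMap_quot_mk.isOpen_preimage.1 ?_
      convert hunit.isOpenMap U hU using 1
      ext p
      constructor
      · rintro ⟨x, hx, hxp⟩
        exact ⟨x, hx, (R.eq_of_mk_unit_eq hxp.symm).symm⟩
      · rintro ⟨x, hx, rfl⟩
        exact ⟨x, hx, rfl⟩
  have hdense : DenseRange (Quotient.mk R.toSetoid ∘ (stoneCechUnit : X → StoneCech X)) :=
    Quotient.mk_surjective.denseRange.comp denseRange_stoneCechUnit R.continuous_quotientMk
  have hind : IsEmbedding R.extensionEmb :=
    .of_comp (hc.subtype_mk _) continuous_subtype_val hemb.isEmbedding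
  refine ⟨⟨hind.isInducing, fun t => ?_⟩, hind.injective⟩
  rw [closure_subtype, ← range_comp]
  exact hdense t.1

/-- The extension of `X` obtained from a closed partial equivalence relation. -/
def toExtension [T35Space X] [LocallyCompactSpace X] : SpaceExtension X where
  carrier := R.ExtensionSpace
  emb := R.extensionEmb
  isDenseEmbedding := R.isDenseEmbedding_extensionEmb

variable [T35Space X] [LocallyCompactSpace X]

theorem hasCompactRemainder_toExtension : R.toExtension.HasCompactRemainder := by
  have hdom : IsClosed {p | (p, p) ∈ R.1} :=
    R.2.1.preimage (continuous_id.prodMk continuous_id)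
  change IsCompact (range R.extensionEmb)ᶜ
  rw [Subtype.isCompact_iff]
  convert hdom.isCompact.image R.continuous_quotientMk using 1
  ext z
  constructor
  · rintro ⟨t, ht, rfl⟩
    obtain ⟨p, hp, rfl⟩ := R.exists_extensionMk_eq ht
    exact ⟨p, hp, rfl⟩
  · rintro ⟨p, hp, rfl⟩
    exact ⟨R.extensionMk hp, R.extensionMk_notMem_range hp, rfl⟩

/-- An unbounded function on the extension is unbounded on X, hence blows up along an ultrafilter
converging to some `p` outside υX. But `p` is in the domain of `R`, so the ultrafilter converges in
the extension, where the function is finite. -/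
theorem isPseudocompactSpace_toExtension (hA : (hewittSet X)ᶜ ⊆ A) :
    IsPseudocompactSpace R.toExtension.carrier := by
  intro f hf
  by_contra hcon
  have hunb : ∀ C, ∃ x, C < |f (R.extensionEmb x)| := by
    by_contra! h
    obtain ⟨C, hC⟩ := h
    refine hcon ⟨C, fun t => ?_⟩
    exact closure_minimal (range_subset_iff.2 hC)
      (isClosed_le hf.abs continuous_const) (R.isDenseEmbedding_extensionEmb.dense t)
  obtain ⟨u, p, hu, hup, hp⟩ := exists_ultrafilter_of_unbounded
    (hf.comp R.isDenseEmbedding_extensionEmb.continuous) hunb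
  have hpR := R.2.2.2.2.1 p (hA hp)
  exact not_tendsto_nhds_of_tendsto_atTop hu _
    ((hf.abs.tendsto _).comp (R.tendsto_extensionEmb hpR hup))

/-- The class of a point of the domain of `R`, as a point of the extension. -/
def remainderPoint {p : StoneCech X} (hp : (p, p) ∈ R.1) : R.toExtension.carrier :=
  R.extensionMk hp

theorem stoneCechMap_toExtension {p : StoneCech X} (hp : (p, p) ∈ R.1) :
    R.toExtension.stoneCechMap p = stoneCechUnit (R.remainderPoint hp) := by
  have hne := comap_stoneCechUnit_nhds_neBot p
  have h1 : Tendsto (stoneCechUnit ∘ R.toExtension.emb) (comap stoneCechUnit (𝓝 p))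
      (𝓝 (stoneCechUnit (R.remainderPoint hp))) :=
    (continuous_stoneCechUnit.tendsto _).comp (R.tendsto_extensionEmb hp tendsto_comap)
  have h2 : Tendsto (stoneCechUnit ∘ R.toExtension.emb) (comap stoneCechUnit (𝓝 p))
      (𝓝 (R.toExtension.stoneCechMap p)) :=
    ((R.toExtension.continuous_stoneCechMap.tendsto p).comp tendsto_comap).congr
      R.toExtension.stoneCechMap_unit
  exact tendsto_nhds_unique h2 h1

/-- The inclusion of the extension into the quotient of `βX`. -/
def extensionVal (t : R.toExtension.carrier) : Quotient R.toSetoid :=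
  Subtype.val (p := (· ∈ Quotient.mk R.toSetoid '' (range stoneCechUnit ∪ {p | (p, p) ∈ R.1}))) t

theorem continuous_extensionVal : Continuous R.extensionVal :=
  continuous_subtype_val (X := Quotient R.toSetoid)
    (p := (· ∈ Quotient.mk R.toSetoid '' (range stoneCechUnit ∪ {p | (p, p) ∈ R.1})))

theorem remainderRel_toExtension : R.toExtension.remainderRel = R.1 := by
  ext ⟨p, q⟩
  constructor
  · rintro ⟨hpq, t, ht, htp⟩
    have hv := R.continuous_extensionVal
    -- The quotient of βX is compact Hausdorff, so the quotient map factors through βT; points with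
    -- equal image in βT are therefore equivalent.
    have hcomp : stoneCechExtend hv ∘ R.toExtension.stoneCechMap = Quotient.mk R.toSetoid :=
      stoneCech_hom_ext ((continuous_stoneCechExtend hv).comp
        R.toExtension.continuous_stoneCechMap) R.continuous_quotientMk (funext fun x => by
          rw [Function.comp_apply, Function.comp_apply, SpaceExtension.stoneCechMap_unit,
            stoneCechExtend_stoneCechUnit]
          rfl)
    have hval : ∀ s, R.toExtension.stoneCechMap s = R.toExtension.stoneCechMap p →
        Quotient.mk R.toSetoid s = R.extensionVal t := fun s hs => by
      rw [← hcomp, Function.comp_apply, hs, ← htp, stoneCechExtend_stoneCechUnit]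
    obtain ⟨r, hr, rfl⟩ := R.exists_extensionMk_eq ht
    -- Comparison with a representative `r` in the domain turns the diagonal alternative of
    -- `toSetoid` into a pair of `R`.
    have hmk : ∀ s, R.toExtension.stoneCechMap s = R.toExtension.stoneCechMap p →
        (s, r) ∈ R.1 := fun s hs => by
      rcases Quotient.exact (hval s hs) with rfl | h
      · exact hr
      · exact h
    exact R.2.2.2.1 _ _ _ (hmk p rfl) (R.2.2.1 _ _ (hmk q hpq.symm))
  · intro h
    have hp := R.refl_left h
    have hq := R.refl_right h
    refine ⟨?_, _, R.extensionMk_notMem_range hp, (R.stoneCechMap_toExtension hp).symm⟩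
    have hpq : R.remainderPoint hp = R.remainderPoint hq :=
      Subtype.ext (Quotient.sound (Or.inr h))
    exact (R.stoneCechMap_toExtension hp).trans
      ((congrArg stoneCechUnit hpq).trans (R.stoneCechMap_toExtension hq).symm)

end ClosedPER

/-! ### The order duality and the theorem -/

/-- The pseudocompactifications with compact remainder correspond to the closed partial equivalence
relations on `βX` whose domain contains `cl (βX \ υX)` and is disjoint from `X`. -/
theorem nonempty_orderIso_closedPER {X : Type u} [TopologicalSpace X] [T35Space X]
    [LocallyCompactSpace X] : Nonempty ((PseudocompactificationsCR X)ᵒᵈ ≃o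
      ClosedPER (closure (hewittSet X)ᶜ) (range stoneCechUnit)ᶜ) := by
  choose E hE hps hcr using fun c : (PseudocompactificationsCR X)ᵒᵈ => (OrderDual.ofDual c).2
  have hle : ∀ c d : (PseudocompactificationsCR X)ᵒᵈ,
      (E c).remainderRel ⊆ (E d).remainderRel ↔ c ≤ d := fun c d => by
    rw [← SpaceExtension.below_iff_remainderRel_subset]
    change _ ↔ (OrderDual.ofDual d).1 ≤ (OrderDual.ofDual c).1
    rw [← hE c, ← hE d]
    rfl
  refine ⟨RelIso.ofSurjective (OrderEmbedding.ofMapLEIff (fun c => ⟨(E c).remainderRel,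
    SpaceExtension.isClosedPER_remainderRel (hcr c) (hps c)⟩) hle) fun R => ?_⟩
  let c : (PseudocompactificationsCR X)ᵒᵈ := OrderDual.toDual ⟨Quotient.mk _ R.toExtension,
    R.toExtension, rfl, R.isPseudocompactSpace_toExtension subset_closure,
    R.hasCompactRemainder_toExtension⟩
  refine ⟨c, Subtype.ext ?_⟩
  have heq : SpaceExtension.Equivalent (E c) R.toExtension := Quotient.exact (hE c)
  rw [← R.remainderRel_toExtension]
  exact Subset.antisymm ((SpaceExtension.below_iff_remainderRel_subset _ _).1 heq.below)
    ((SpaceExtension.below_iff_remainderRel_subset _ _).1 heq.symm.below)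

theorem mainTheorem2 {X Y : Type*} [TopologicalSpace X] [TopologicalSpace Y]
    [T35Space X] [T35Space Y] [LocallyCompactSpace X] [LocallyCompactSpace Y]
    (hX : ¬ IsPseudocompactSpace X) (hY : ¬ IsPseudocompactSpace Y)
    (h : Nonempty (PseudocompactificationsCR X ≃o PseudocompactificationsCR Y)) :
    Nonempty (outgrowthPart X ≃ₜ outgrowthPart Y) := by
  obtain ⟨e⟩ := h
  obtain ⟨eX⟩ := nonempty_orderIso_closedPER (X := X)
  obtain ⟨eY⟩ := nonempty_orderIso_closedPER (X := Y)
  exact ClosedPER.nonempty_homeomorph isClosed_closure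
    isOpenEmbedding_stoneCechUnit.isOpen_range.isClosed_compl closure_compl_hewittSet_subset
    (nonempty_compl_hewittSet hX).closure isClosed_closure
    isOpenEmbedding_stoneCechUnit.isOpen_range.isClosed_compl closure_compl_hewittSet_subset
    (nonempty_compl_hewittSet hY).closure (eX.symm.trans (e.dual.trans eY))
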